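/- Theorem 1. Let $K,N\ge 2$ and $U=(K-1)N$. In the $(K,N)$ D2D private caching system with a trusted server there are $N$ independent files $F_1,\dots,F_N$ of $B$ i.i.d. uniform bits each and $K$ users. The cache of user $k$ is $Z_k=(\mathscr M(C_k),C_k)$, where the placement metadata $(\mathscr M(C_1),\dots,\mathscr M(C_K))$ is random and independent of the files and of the demands, and the content $C_k$ is a function of $\mathscr M(C_k)$ and the files; the placement is uncoded if, given $\mathscr M(C_k)$, $C_k$ consists of bits copied directly from the files. For a demand vector $\mathbf D=(D_1,\dots,D_K)\in[N]^K$ independent of the files, the trusted server, which does not access the files, draws metadata $\mathscr M(P_1),\dots,\mathscr M(P_K)$ depending on $\mathbf D$ and the placement metadata; user $k$ then broadcasts $X_k=(\mathscr M(P_k),P_k)$, where the payload $P_k$ is a function of $\mathscr M(P_k)$ and $Z_k$. Write $\mathbf X=(X_1,\dots,X_K)$. For a cache size $M\in[N/K,N]$, a load $R$ is achievable under uncoded placement and user collusion if there are $\epsilon_B\ge 0$ with $\lim_{B\to\infty}\epsilon_B=0$ such that for every sufficiently large $B$ there is a scheme with uncoded placement which, for every distribution of $\mathbf D$, satisfies,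 for all $k\in[K]$, $H(\mathscr M(C_k))\le B\epsilon_B$, $H(\mathscr M(P_k))\le B\epsilon_B$, $H(Z_k)\le B(M+\epsilon_B)$ and $H(F_{D_k}\mid \mathbf X,Z_k,D_k)\le B\epsilon_B$, and, moreover, $\sum_{k\in[K]}H(X_k)\le B(R+\epsilon_B)$ and $$I\big(\mathbf D;\mathbf X,(Z_k)_{k\in\mathcal S}\,\big|\,(D_k)_{k\in\mathcal S}\big)=0\qquad\text{for all }\emptyset\ne\mathcal S\subseteq[K].$$ Let $R^\star_{\mathrm{u,c}}(M)$ be the infimum of the achievable loads. Then, for every $M\in[N/K,N]$, $R^\star_{\mathrm{u,c}}(M)$ is at most the value at $M$ of the lower convex envelope of the points $$\left(\frac{N+t-1}{K},\ \frac{\binom{U}{t}-\binom{U-N}{t}}{\binom{U}{t-1}}\right),\qquad t\in\{1,\dots,U+1\},$$ where $\binom{x}{y}=0$ if $x<y$. -/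

import Mathlib

open scoped Topology

noncomputable section

namespace D2DCaching

/-! ### Shannon quantities, in bits, of random variables on a finite probability space -/

section Entropy

variable {Ω α β γ : Type*} [Fintype Ω]

open Classical in
/-- Shannon entropy `H(X)` in bits; the sum runs over the range of `X`. -/
def entropy (p : PMF Ω) (X : Ω → α) : ℝ :=
  ∑ x ∈ Finset.univ.image X, Real.negMulLog ((p.map X x).toReal) / Real.log 2

/-- Conditional entropy `H(X | Y) = H(X, Y) - H(Y)`. -/
def condEntropy (p : PMF Ω) (X : Ω → α) (Y : Ω → β) : ℝ :=
  entropy p (fun ω => (X ω, Y ω)) - entropy p Y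

/-- Conditional mutual information `I(X; Y | Z) = H(X | Z) - H(X | Y, Z)`. -/
def condMutualInfo (p : PMF Ω) (X : Ω → α) (Y : Ω → β) (Z : Ω → γ) : ℝ :=
  condEntropy p X Z - condEntropy p X (fun ω => (Y ω, Z ω))

end Entropy

/-! ### The D2D caching system with a trusted server -/

/-- A library of `N` files of `B` bits each. -/
abbrev Library (N B : ℕ) : Type := Fin N → Fin B → Bool

/-- A demand vector of `K` users. -/
abbrev Demands (K N : ℕ) : Type := Fin K → Fin N

/-- A caching scheme with `K` users, `N` files and `B` bits per file.
The placement metadata is drawn without looking at the library or at the demands. The trusted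
server knows the demands and the placement metadata of all users, but not the library, and draws
the metadata of the transmissions. The payload of user `k` is computed from the metadata of its
transmission and from its own cache (placement metadata and cached content) alone. -/
structure Scheme (K N B : ℕ) where
  /-- the set of possible metadata of the cache of each user -/
  CacheMeta : Fin K → Type
  /-- the set of possible metadata of the transmission of each user -/
  SendMeta : Fin K → Type
  cacheMetaFintype : ∀ k, Fintype (CacheMeta k)
  sendMetaFintype : ∀ k, Fintype (SendMeta k)
  /-- joint law of the placement metadata of all users -/
  placement : PMF (∀ k, CacheMeta k)
  /-- cached content, as a function of the metadata and of the library -/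
  content : ∀ k, CacheMeta k → Library N B → List Bool
  /-- joint law of the transmission metadata chosen by the trusted server -/
  query : Demands K N → (∀ k, CacheMeta k) → PMF (∀ k, SendMeta k)
  /-- broadcast payload, as a function of the transmission metadata and of the user's cache -/
  payload : ∀ k, SendMeta k → CacheMeta k × List Bool → List Bool

namespace Scheme

variable {K N B : ℕ} (𝒮 : Scheme K N B)

instance (k : Fin K) : Fintype (𝒮.CacheMeta k) := 𝒮.cacheMetaFintype k

instance (k : Fin K) : Fintype (𝒮.SendMeta k) := 𝒮.sendMetaFintype k

/-- Sample space: library, demands, placement metadata, transmission metadata. -/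
abbrev Outcome : Type :=
  Library N B × Demands K N × (∀ k, 𝒮.CacheMeta k) × (∀ k, 𝒮.SendMeta k)

/-- Joint law when the demand vector has law `q`: the library consists of i.i.d. uniform bits;
library, demands and placement metadata are independent; the transmission metadata is drawn given
the demands and the placement metadata. -/
def law (q : PMF (Demands K N)) : PMF 𝒮.Outcome :=
  (PMF.uniformOfFintype (Library N B)).bind fun F =>
    q.bind fun d =>
      𝒮.placement.bind fun c =>
        (𝒮.query d c).map fun m => (F, d, c, m)

/-- The demand vector `D`. -/
def demands (ω : 𝒮.Outcome) : Demands K N := ω.2.1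

/-- The file demanded by user `k`. -/
def demandedFile (k : Fin K) (ω : 𝒮.Outcome) : Fin B → Bool := ω.1 (ω.2.1 k)

/-- The metadata of the cache of user `k`. -/
def cacheMeta (k : Fin K) (ω : 𝒮.Outcome) : 𝒮.CacheMeta k := ω.2.2.1 k

/-- The metadata of the transmission of user `k`. -/
def sendMeta (k : Fin K) (ω : 𝒮.Outcome) : 𝒮.SendMeta k := ω.2.2.2 k

/-- The cache `Z_k` of user `k`: placement metadata and cached content. -/
def cache (k : Fin K) (ω : 𝒮.Outcome) : 𝒮.CacheMeta k × List Bool :=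
  (𝒮.cacheMeta k ω, 𝒮.content k (𝒮.cacheMeta k ω) ω.1)

/-- The signal `X_k` broadcast by user `k`: transmission metadata and payload. -/
def signal (k : Fin K) (ω : 𝒮.Outcome) : 𝒮.SendMeta k × List Bool :=
  (𝒮.sendMeta k ω, 𝒮.payload k (𝒮.sendMeta k ω) (𝒮.cache k ω))

/-- The vector `X` of all broadcast signals. -/
def signals (ω : 𝒮.Outcome) : ∀ k, 𝒮.SendMeta k × List Bool := fun k => 𝒮.signal k ω

/-- Uncoded placement: given its metadata, the cached content of each user is a list of bits
copied directly from the files. -/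
def IsUncoded : Prop :=
  ∀ (k : Fin K) (c : 𝒮.CacheMeta k), ∃ pos : List (Fin N × Fin B),
    ∀ F : Library N B, 𝒮.content k c F = pos.map fun ib => F ib.1 ib.2

/-- The constraints on a scheme when the demands have law `q`, for cache size `M`, load `R` and
slack `ε`, with privacy against colluding users. -/
structure Meets (q : PMF (Demands K N)) (M R ε : ℝ) : Prop where
  /-- the placement metadata is negligible with respect to the file size -/
  cacheMeta_le : ∀ k, entropy (𝒮.law q) (𝒮.cacheMeta k) ≤ B * ε
  /-- the transmission metadata is negligible with respect to the file size -/
  sendMeta_le : ∀ k, entropy (𝒮.law q) (𝒮.sendMeta k) ≤ B * ε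
  /-- cache size: `H(Z_k) ≤ B (M + ε)` -/
  cache_le : ∀ k, entropy (𝒮.law q) (𝒮.cache k) ≤ B * (M + ε)
  /-- decoding: `H(F_{D_k} | X, Z_k, D_k) ≤ B ε` -/
  decoding : ∀ k, condEntropy (𝒮.law q) (𝒮.demandedFile k)
    (fun ω => (𝒮.signals ω, 𝒮.cache k ω, 𝒮.demands ω k)) ≤ B * ε
  /-- privacy: `I(D; X, (Z_k)_{k ∈ T} | (D_k)_{k ∈ T}) = 0` for all nonempty sets `T` of users -/
  privacy : ∀ T : Finset (Fin K), T.Nonempty →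
    condMutualInfo (𝒮.law q) 𝒮.demands
      (fun ω => (𝒮.signals ω, fun k : T => 𝒮.cache k.1 ω))
      (fun ω => fun k : T => 𝒮.demands ω k.1) = 0
  /-- load: `∑ k, H(X_k) ≤ B (R + ε)` -/
  load_le : ∑ k, entropy (𝒮.law q) (𝒮.signal k) ≤ B * (R + ε)

end Scheme

/-- The load `R` is achievable with cache size `M` under uncoded placement and privacy against
colluding users: for some `ε_B → 0`, for all large file sizes `B` there is an uncoded scheme that
meets the constraints with slack `ε_B`, whatever the law of the demands is. -/
def Achievable (K N : ℕ) (M R : ℝ) : Prop :=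
  ∃ ε : ℕ → ℝ, (∀ B, 0 ≤ ε B) ∧ Filter.Tendsto ε Filter.atTop (𝓝 0) ∧
    ∀ᶠ B : ℕ in Filter.atTop, ∃ 𝒮 : Scheme K N B, 𝒮.IsUncoded ∧
      ∀ q : PMF (Demands K N), 𝒮.Meets q M R (ε B)

/-- The optimal load `R*_{u,c}(M)`: the infimum of the achievable loads (`⊤` if there are none). -/
def optimalLoad (K N : ℕ) (M : ℝ) : EReal :=
  sInf ((fun R : ℝ => (R : EReal)) '' {R : ℝ | Achievable K N M R})

/-- The lower convex envelope of a set of points of the plane at abscissa `x`: the lower boundary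
of the convex hull (`⊤` if no point of the hull has abscissa `x`). -/
def lowerConvexEnvelope (P : Set (ℝ × ℝ)) (x : ℝ) : EReal :=
  sInf ((fun r : ℝ => (r : EReal)) '' {r : ℝ | (x, r) ∈ convexHull ℝ P})

/-- The points `((N + t - 1) / K, (C(U, t) - C(U - N, t)) / C(U, t - 1))` for `1 ≤ t ≤ U + 1`,
where `U = (K - 1) N`. -/
def schemeAPoints (K N : ℕ) : Set (ℝ × ℝ) :=
  let U : ℕ := (K - 1) * N
  {P | ∃ t : ℕ, 1 ≤ t ∧ t ≤ U + 1 ∧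
    P = (((N : ℝ) + t - 1) / K,
      ((U.choose t : ℝ) - ((U - N).choose t : ℝ)) / (U.choose (t - 1) : ℝ))}

end D2DCaching

end

/-
Every user draws a uniform shift, and the differences between the demands and the shifts are
broadcast. By the one-time pad these differences are uniform and independent of the demands, so
that a group of colluding users learns nothing beyond its own demands. The shift of a user `j` is
also its position among `N` slots: in the transmission of another user `k`, all the slots of `j`
are served, with demands that together cover every file exactly once, and `j` caches what the slot
of its actual shift caches.

The bits of every file are divided among the transmitting users `k`, and those of `k` among the
sets of its `U = (K - 1) N` slots. A slot `v` decodes a bit cached by `W` from the multicast message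
of `insert v W`, as it knows all other summands. The sum over all transversals (choices of one slot
per file) of the messages of their complements in a set `T` vanishes. This recovers the
messages of the sets that miss all slots of a leading user and brings their number down to
`C(U, t) - C(U - N, t)`. Using parts cached by different numbers of slots, in the right
proportions, gives all points of the convex hull, not only the corner points.
-/

noncomputable section

namespace D2DCaching

section Entropy

variable {Ω Ω' α β γ δ : Type*} [Fintype Ω] [Fintype Ω']

lemma toReal_map_apply [DecidableEq α] (p : PMF Ω) (X : Ω → α) (x : α) :
    (p.map X x).toReal = ∑ ω with X ω = x, (p ω).toReal := by
  rw [PMF.map_apply, tsum_fintype, ENNReal.toReal_sum, Finset.sum_filter]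
  · exact Finset.sum_congr rfl fun ω _ => by split_ifs <;> simp_all
  · intro ω _
    split_ifs
    exacts [p.apply_ne_top ω, ENNReal.zero_ne_top]

lemma sum_toReal_map_mul (p : PMF Ω) (X : Ω → α) {s : Finset α} (hs : ∀ ω, X ω ∈ s) (g : α → ℝ) :
    ∑ x ∈ s, (p.map X x).toReal * g x = ∑ ω, (p ω).toReal * g (X ω) := by
  classical
  rw [← Finset.sum_fiberwise_of_maps_to (t := s) (g := X) fun ω _ => hs ω]
  refine Finset.sum_congr rfl fun x _ => ?_
  rw [toReal_map_apply, Finset.sum_mul]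
  exact Finset.sum_congr rfl fun ω hω => by rw [(Finset.mem_filter.1 hω).2]

omit [Fintype Ω] in
lemma toReal_map_apply_ne_zero (p : PMF Ω) (X : Ω → α) {ω : Ω} (hω : p ω ≠ 0) :
    (p.map X (X ω)).toReal ≠ 0 := by
  refine ENNReal.toReal_ne_zero.2 ⟨?_, PMF.apply_ne_top _ _⟩
  rw [← PMF.mem_support_iff, PMF.mem_support_map_iff]
  exact ⟨ω, (p.mem_support_iff ω).2 hω, rfl⟩

lemma sum_toReal_eq_one (p : PMF Ω) : ∑ ω, (p ω).toReal = 1 := by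
  rw [← ENNReal.toReal_sum fun ω _ => p.apply_ne_top ω, ← tsum_fintype (L := .unconditional _),
    p.tsum_coe, ENNReal.toReal_one]

lemma entropy_eq_sum_logb (p : PMF Ω) (X : Ω → α) :
    entropy p X = ∑ ω, (p ω).toReal * -Real.logb 2 (p.map X (X ω)).toReal := by
  classical
  rw [← sum_toReal_map_mul p X (s := Finset.univ.image X) (by simp)
    fun x => -Real.logb 2 (p.map X x).toReal, entropy]
  refine Finset.sum_congr (by congr!) fun x _ => ?_
  rw [Real.negMulLog, Real.logb]
  ring

lemma entropy_congr (p : PMF Ω) {X : Ω → α} {Y : Ω → β}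
    (h : ∀ ω ω', X ω = X ω' ↔ Y ω = Y ω') : entropy p X = entropy p Y := by
  classical
  simp only [entropy_eq_sum_logb, toReal_map_apply, h]

lemma entropy_map (p : PMF Ω) (g : Ω → Ω') (X : Ω' → α) :
    entropy (p.map g) X = entropy p (X ∘ g) := by
  rw [entropy_eq_sum_logb, entropy_eq_sum_logb, PMF.map_comp]
  exact sum_toReal_map_mul p g (fun ω => Finset.mem_univ (g ω)) _

lemma condEntropy_map (p : PMF Ω) (g : Ω → Ω') (X : Ω' → α) (Y : Ω' → β) :
    condEntropy (p.map g) X Y = condEntropy p (X ∘ g) (Y ∘ g) := by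
  rw [condEntropy, entropy_map, entropy_map]
  rfl

lemma condMutualInfo_map (p : PMF Ω) (g : Ω → Ω') (X : Ω' → α) (Y : Ω' → β) (Z : Ω' → γ) :
    condMutualInfo (p.map g) X Y Z = condMutualInfo p (X ∘ g) (Y ∘ g) (Z ∘ g) := by
  rw [condMutualInfo, condEntropy_map, condEntropy_map]
  rfl

lemma condEntropy_eq_zero (p : PMF Ω) {X : Ω → α} {Y : Ω → β}
    (h : X.FactorsThrough Y) : condEntropy p X Y = 0 := by
  refine sub_eq_zero.2 (entropy_congr p fun ω ω' => ?_)
  rw [Prod.mk.injEq]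
  exact and_iff_right_of_imp fun hY => h hY

lemma entropy_le_logb_card [Fintype α] (p : PMF Ω) (X : Ω → α) :
    entropy p X ≤ Real.logb 2 (Fintype.card α) := by
  classical
  set n : ℝ := (Fintype.card α : ℝ)
  have hn : 0 < n := by
    obtain ⟨ω, -⟩ := p.support_nonempty
    exact Nat.cast_pos.2 (Fintype.card_pos_iff.2 ⟨X ω⟩)
  have hsum : ∑ x, (p.map X x).toReal = 1 := by
    simpa [sum_toReal_eq_one] using sum_toReal_map_mul p X (fun ω => Finset.mem_univ (X ω)) 1
  have jensen : ∑ x, n⁻¹ * Real.negMulLog (p.map X x).toReal ≤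
      Real.negMulLog (∑ x, n⁻¹ * (p.map X x).toReal) :=
    Real.concaveOn_negMulLog.le_map_sum (fun _ _ => inv_nonneg.2 hn.le) (by simp [n, hn.ne'])
      fun _ _ => ENNReal.toReal_nonneg
  have hsubset : ∑ x ∈ Finset.univ.image X, Real.negMulLog (p.map X x).toReal ≤
      ∑ x, Real.negMulLog (p.map X x).toReal :=
    Finset.sum_le_univ_sum_of_nonneg fun x =>
      Real.negMulLog_nonneg ENNReal.toReal_nonneg
        (ENNReal.toReal_mono ENNReal.one_ne_top ((p.map X).coe_le_one x))
  rw [← Finset.mul_sum, ← Finset.mul_sum, hsum, mul_one, Real.negMulLog, Real.log_inv, neg_mul_neg,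
    mul_le_mul_iff_right₀ (inv_pos.2 hn)] at jensen
  rw [entropy, ← Finset.sum_div, Real.logb]
  gcongr
  refine le_trans (le_of_eq ?_) (hsubset.trans jensen)
  congr!

lemma entropy_prodMk_list_le [Fintype α] (p : PMF Ω) (m : Ω → α) (l : Ω → List Bool) {n : ℕ}
    (hlen : Function.FactorsThrough (fun ω => (l ω).length) m) (hn : ∀ ω, (l ω).length ≤ n) :
    entropy p (fun ω => (m ω, l ω)) ≤ Real.logb 2 (Fintype.card α) + n := by
  have hpad : entropy p (fun ω => (m ω, l ω)) =
      entropy p fun ω => (m ω, fun i : Fin n => (l ω).getD i false) := by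
    refine entropy_congr p fun ω ω' => ?_
    simp only [Prod.mk.injEq]
    refine and_congr_right fun hm => ⟨fun h => by rw [h], fun h => ?_⟩
    refine List.ext_getElem (hlen hm) fun i hi hi' => ?_
    simpa [hi, hi'] using congrFun h ⟨i, hi.trans_le (hn ω)⟩
  obtain ⟨ω, -⟩ := p.support_nonempty
  have hα : (Fintype.card α : ℝ) ≠ 0 := Nat.cast_ne_zero.2 (Fintype.card_pos_iff.2 ⟨m ω⟩).ne'
  refine (hpad.trans_le (entropy_le_logb_card p _)).trans_eq ?_
  rw [Fintype.card_prod, Fintype.card_fun, Fintype.card_bool, Fintype.card_fin, Nat.cast_mul,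
    Nat.cast_pow, Nat.cast_ofNat, Real.logb_mul hα (by positivity), Real.logb_pow,
    Real.logb_self_eq_one one_lt_two, mul_one]

/-- The joint law of `X` with law `q` and of a `Y` which, given `X = x`, has law `κ x`. -/
def jointLaw (q : PMF α) (κ : α → PMF β) : PMF (α × β) :=
  q.bind fun x => (κ x).map (Prod.mk x)

/-- The joint law of two independent random variables with laws `q` and `μ`. -/
abbrev prodLaw (q : PMF α) (μ : PMF β) : PMF (α × β) :=
  jointLaw q fun _ => μ

lemma jointLaw_apply (q : PMF α) (κ : α → PMF β) (x : α) (y : β) :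
    jointLaw q κ (x, y) = q x * κ x y := by
  classical
  rw [jointLaw, PMF.bind_apply, tsum_eq_single x, PMF.map_apply, tsum_eq_single y, if_pos rfl]
  · exact fun y' hy => if_neg fun h => hy (Prod.mk.inj h).2.symm
  · intro x' hx
    rw [PMF.map_apply, mul_eq_zero]
    exact Or.inr (ENNReal.tsum_eq_zero.2 fun y' => if_neg fun h => hx (Prod.mk.inj h).1.symm)

lemma map_fst_jointLaw (q : PMF α) (κ : α → PMF β) : (jointLaw q κ).map Prod.fst = q := by
  simp only [jointLaw, PMF.map_bind, PMF.map_comp]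
  exact (congrArg q.bind (funext fun x => (κ x).map_const x)).trans q.bind_pure

lemma map_prodLaw (q : PMF α) (μ : PMF β) (a : α → γ) (f : γ → β → δ) :
    (prodLaw q μ).map (fun ω => (a ω.1, f (a ω.1) ω.2)) =
      jointLaw (q.map a) fun z => μ.map (f z) := by
  simp only [jointLaw, PMF.map_bind, PMF.bind_map, PMF.map_comp]
  rfl

lemma entropy_prodLaw (q : PMF Ω) (μ : PMF Ω') (a : Ω → γ) (f : γ → Ω' → δ) :
    entropy (prodLaw q μ) (fun ω => (a ω.1, f (a ω.1) ω.2)) =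
      entropy q a + ∑ x, (q x).toReal * entropy μ (f (a x)) := by
  simp only [entropy_eq_sum_logb, map_prodLaw, jointLaw_apply, Fintype.sum_prod_type,
    ← Finset.sum_add_distrib, ENNReal.toReal_mul]
  refine Finset.sum_congr rfl fun x _ => ?_
  set P := (q.map a (a x)).toReal
  rcases eq_or_ne (q x) 0 with hx | hx
  · simp [hx]
  have split : ∀ w, (μ w).toReal * -Real.logb 2 (P * (μ.map (f (a x)) (f (a x) w)).toReal) =
      (μ w).toReal * -Real.logb 2 P +
        (μ w).toReal * -Real.logb 2 (μ.map (f (a x)) (f (a x) w)).toReal := by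
    intro w
    rcases eq_or_ne (μ w) 0 with hw | hw
    · simp [hw]
    rw [Real.logb_mul (toReal_map_apply_ne_zero q a hx) (toReal_map_apply_ne_zero μ _ hw)]
    ring
  simp only [mul_assoc, ← Finset.mul_sum]
  rw [Finset.sum_congr rfl fun w _ => split w, Finset.sum_add_distrib, ← Finset.sum_mul,
    sum_toReal_eq_one, one_mul, mul_add]

lemma entropy_prodLaw_fst (q : PMF Ω) (μ : PMF Ω') (X : Ω → γ) :
    entropy (prodLaw q μ) (fun ω => X ω.1) = entropy q X := by
  have h := entropy_map (prodLaw q μ) Prod.fst X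
  rw [map_fst_jointLaw] at h
  exact h.symm

lemma condMutualInfo_prodLaw_eq_zero (q : PMF Ω) (μ : PMF Ω') (a : Ω → γ) (f : γ → Ω' → δ) :
    condMutualInfo (prodLaw q μ) Prod.fst (fun ω => f (a ω.1) ω.2) (fun ω => a ω.1) = 0 := by
  have fst_pair : entropy (prodLaw q μ) (fun ω => (ω.1, a ω.1)) = entropy q id := by
    rw [← entropy_prodLaw_fst q μ id]
    exact entropy_congr _ fun ω ω' => by simp +contextual
  have chain : entropy (prodLaw q μ) (fun ω => (f (a ω.1) ω.2, a ω.1)) =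
      entropy q a + ∑ x, (q x).toReal * entropy μ (f (a x)) := by
    rw [← entropy_prodLaw]
    exact entropy_congr _ fun ω ω' => by simp only [Prod.mk.injEq, and_comm]
  have chain_fst : entropy (prodLaw q μ) (fun ω => (ω.1, f (a ω.1) ω.2, a ω.1)) =
      entropy q id + ∑ x, (q x).toReal * entropy μ (f (a x)) := by
    refine .trans (entropy_congr _ fun ω ω' => ?_) (entropy_prodLaw q μ id fun x => f (a x))
    simp only [Prod.mk.injEq, id_eq]
    exact and_congr_right fun h => and_iff_left_of_imp fun _ => congrArg a h
  rw [condMutualInfo, condEntropy, condEntropy, fst_pair, entropy_prodLaw_fst, chain, chain_fst]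
  ring

end Entropy

lemma logb_two_natCast_nonneg (n : ℕ) : 0 ≤ Real.logb 2 n :=
  div_nonneg (Real.log_natCast_nonneg n) (Real.log_nonneg one_le_two)

lemma map_uniformOfFintype {α β : Type*} [Fintype α] [Nonempty α] [Fintype β] [Nonempty β]
    (e : α ≃ β) : (PMF.uniformOfFintype α).map e = PMF.uniformOfFintype β := by
  classical
  ext b
  rw [PMF.map_apply, tsum_eq_single (e.symm b)]
  · rw [if_pos (e.apply_symm_apply b).symm, PMF.uniformOfFintype_apply,
      PMF.uniformOfFintype_apply, Fintype.card_congr e]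
  · exact fun a ha => if_neg fun h => ha (e.symm_apply_eq.2 h).symm

/-- A code whose caches depend on a shift `r` of each user, and whose messages depend on the
differences `m` between the demands and the shifts. -/
structure ShiftCode (K N B : ℕ) where
  /-- the positions of the bits of the message of each user -/
  Index : Fin K → Type
  indexFintype : ∀ k, Fintype (Index k)
  /-- the bits cached by each user, as a function of the shift of the user -/
  cached : Fin K → Fin N → Finset (Fin N × Fin B)
  /-- the message of each user, which may depend on all differences -/
  message : ∀ k, Demands K N → Library N B → Index k → Bool

namespace ShiftCode

variable {K N B : ℕ} (C : ShiftCode K N B)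

instance (k : Fin K) : Fintype (C.Index k) := C.indexFintype k

/-- Two libraries agree on a set of positions `(i, b)`, the bit `b` of file `i`. -/
def AgreeOn (P : Finset (Fin N × Fin B)) (F F' : Library N B) : Prop :=
  ∀ p ∈ P, F p.1 p.2 = F' p.1 p.2

/-- The content of the cache of user `k` with shift `r`, as a list of bits. -/
def cacheList (k : Fin K) (r : Fin N) (F : Library N B) : List Bool :=
  (C.cached k r).toList.map fun p => F p.1 p.2

/-- The message of user `k`, as a list of bits. -/
def messageList (k : Fin K) (m : Demands K N) (F : Library N B) : List Bool :=
  Finset.univ.toList.map (C.message k m F)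

lemma length_cacheList (k : Fin K) (r : Fin N) (F : Library N B) :
    (C.cacheList k r F).length = (C.cached k r).card := by
  simp [cacheList]

lemma length_messageList (k : Fin K) (m : Demands K N) (F : Library N B) :
    (C.messageList k m F).length = Fintype.card (C.Index k) := by
  simp [messageList]

variable {C} in
lemma cacheList_eq_iff {k : Fin K} {r : Fin N} {F F' : Library N B} :
    C.cacheList k r F = C.cacheList k r F' ↔ AgreeOn (C.cached k r) F F' := by
  simp [cacheList, AgreeOn, List.map_inj_left]

variable {C} in
lemma messageList_eq_iff {k : Fin K} {m : Demands K N} {F F' : Library N B} :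
    C.messageList k m F = C.messageList k m F' ↔ C.message k m F = C.message k m F' := by
  simp [messageList, List.map_inj_left, funext_iff]

/-- Every user can compute its message from its cache. -/
def IsLocal : Prop :=
  ∀ k r m F F', AgreeOn (C.cached k r) F F' → C.message k m F = C.message k m F'

/-- Every user can decode the file `r + m k`, the one it demands when its shift is `r`, from its
cache and from all messages. -/
def IsDecodable [NeZero N] : Prop :=
  ∀ k r m F F', AgreeOn (C.cached k r) F F' → (∀ j, C.message j m F = C.message j m F') →
    F (r + m k) = F' (r + m k)

variable [NeZero N]

/-- The scheme of a shift code: independent uniform shifts are the placement metadata, and the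
differences between the demands and the shifts are the transmission metadata of every user. -/
def toScheme : Scheme K N B where
  CacheMeta _ := Fin N
  SendMeta _ := Demands K N
  cacheMetaFintype _ := inferInstance
  sendMetaFintype _ := inferInstance
  placement := PMF.uniformOfFintype (Demands K N)
  content := C.cacheList
  query d r := PMF.pure fun _ => d - r
  -- The message is evaluated at an arbitrary library consistent with the cache `z`.
  payload k m z := C.messageList k m (Function.invFun (C.cacheList k z.1) z.2)

lemma isUncoded_toScheme : C.toScheme.IsUncoded :=
  fun k r => ⟨(C.cached k r).toList, fun _ => rfl⟩

/-- The joint law of the demands, the library and the differences: the differences are independent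
of the demands because the shifts act as a one-time pad. -/
abbrev baseLaw (B : ℕ) (q : PMF (Demands K N)) : PMF (Demands K N × Library N B × Demands K N) :=
  prodLaw q (prodLaw (PMF.uniformOfFintype (Library N B)) (PMF.uniformOfFintype (Demands K N)))

/-- The outcome determined by the demands, the library and the differences. -/
def outcome (ω : Demands K N × Library N B × Demands K N) : C.toScheme.Outcome :=
  (ω.2.1, ω.1, ω.1 - ω.2.2, fun _ => ω.2.2)

lemma law_toScheme (q : PMF (Demands K N)) :
    C.toScheme.law q = (baseLaw B q).map C.outcome := by
  have draw : ∀ (d : Demands K N) (F : Library N B) (r : Demands K N),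
      ((C.toScheme.query d r).map fun m => (F, d, r, m)) =
      PMF.pure (C.outcome (d, F, d - r)) := fun d F r =>
    (PMF.pure_map _ _).trans <| congrArg PMF.pure <|
      Prod.ext rfl (Prod.ext rfl (Prod.ext (sub_sub_cancel d r).symm rfl))
  have one_time_pad : ∀ d F, (C.toScheme.placement.bind fun r =>
      (C.toScheme.query d r).map fun m => (F, d, r, m)) =
      (PMF.uniformOfFintype (Demands K N)).map fun m => C.outcome (d, F, m) := by
    intro d F
    rw [← map_uniformOfFintype (Equiv.subLeft d), PMF.map_comp]
    exact congrArg _ (funext (draw d F))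
  rw [Scheme.law, PMF.bind_comm]
  simp only [baseLaw, prodLaw, jointLaw, PMF.map_bind, PMF.map_comp]
  exact congrArg _ (funext fun d => congrArg _ (funext fun F => one_time_pad d F))

variable {C}

lemma signal_outcome (hC : C.IsLocal) (k : Fin K) (ω : Demands K N × Library N B × Demands K N) :
    C.toScheme.signal k (C.outcome ω) = (ω.2.2, C.messageList k ω.2.2 ω.2.1) := by
  refine Prod.ext rfl (messageList_eq_iff.2 (hC k (ω.1 k - ω.2.2 k) _ _ _ ?_))
  rw [← cacheList_eq_iff]
  exact Function.invFun_eq ⟨ω.2.1, rfl⟩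

lemma entropy_cacheMeta_le (q : PMF (Demands K N)) (k : Fin K) :
    entropy (C.toScheme.law q) (C.toScheme.cacheMeta k) ≤ Real.logb 2 N := by
  refine (entropy_le_logb_card _ _).trans_eq ?_
  exact congrArg (fun n : ℕ => Real.logb 2 n) (Fintype.card_fin N)

omit [NeZero N] in
lemma logb_card_demands : Real.logb 2 (Fintype.card (Demands K N)) = K * Real.logb 2 N := by
  rw [Fintype.card_fun, Fintype.card_fin, Fintype.card_fin, Nat.cast_pow, Real.logb_pow]

lemma entropy_sendMeta_le (q : PMF (Demands K N)) (k : Fin K) :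
    entropy (C.toScheme.law q) (C.toScheme.sendMeta k) ≤ K * Real.logb 2 N :=
  (entropy_le_logb_card _ _).trans_eq logb_card_demands

lemma entropy_cache_le (q : PMF (Demands K N)) (k : Fin K) {n : ℕ}
    (hn : ∀ r, (C.cached k r).card ≤ n) :
    entropy (C.toScheme.law q) (C.toScheme.cache k) ≤ Real.logb 2 N + n := by
  refine (entropy_prodMk_list_le _ (C.toScheme.cacheMeta k)
    (fun ω => C.cacheList k (C.toScheme.cacheMeta k ω) ω.1) (n := n) ?_ ?_).trans_eq ?_
  · exact fun ω ω' h => (C.length_cacheList k _ _).trans <|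
      (congrArg (fun r => (C.cached k r).card) h).trans (C.length_cacheList k _ _).symm
  · exact fun ω => (C.length_cacheList k _ _).trans_le (hn _)
  · exact congrArg (fun c : ℕ => Real.logb 2 c + (n : ℝ)) (Fintype.card_fin N)

lemma entropy_signal_le (q : PMF (Demands K N)) (k : Fin K) :
    entropy (C.toScheme.law q) (C.toScheme.signal k) ≤
      K * Real.logb 2 N + Fintype.card (C.Index k) := by
  rw [← logb_card_demands]
  exact entropy_prodMk_list_le _ (C.toScheme.sendMeta k)
    (fun ω => C.toScheme.payload k (C.toScheme.sendMeta k ω) (C.toScheme.cache k ω))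
    (fun ω ω' _ => (C.length_messageList k _ _).trans (C.length_messageList k _ _).symm)
    (fun ω => (C.length_messageList k _ _).le)

lemma condEntropy_demandedFile_eq_zero (hloc : C.IsLocal) (hdec : C.IsDecodable)
    (q : PMF (Demands K N)) (k : Fin K) :
    condEntropy (C.toScheme.law q) (C.toScheme.demandedFile k)
      (fun ω => (C.toScheme.signals ω, C.toScheme.cache k ω, C.toScheme.demands ω k)) = 0 := by
  rw [law_toScheme, condEntropy_map]
  refine condEntropy_eq_zero _ ?_
  rintro ⟨d, F, m⟩ ⟨d', F', m'⟩ h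
  have hsignal : ∀ j, (m, C.messageList j m F) = (m', C.messageList j m' F') := fun j =>
    (signal_outcome hloc j (d, F, m)).symm.trans <|
      (congrFun (congrArg Prod.fst h) j).trans (signal_outcome hloc j (d', F', m'))
  obtain rfl : m = m' := congrArg Prod.fst (hsignal k)
  have hdemand : d k = d' k := congrArg (fun y => y.2.2) h
  have hcache : C.cacheList k (d k - m k) F = C.cacheList k (d' k - m k) F' :=
    congrArg (fun y => y.2.1.2) h
  rw [← hdemand, cacheList_eq_iff] at hcache
  have hfile := hdec k (d k - m k) m F F' hcache fun j =>
    messageList_eq_iff.1 (congrArg Prod.snd (hsignal j))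
  rw [sub_add_cancel] at hfile
  exact hfile.trans (congrArg F' hdemand)

lemma condMutualInfo_demands_eq_zero (hloc : C.IsLocal) (q : PMF (Demands K N))
    (T : Finset (Fin K)) :
    condMutualInfo (C.toScheme.law q) C.toScheme.demands
      (fun ω => (C.toScheme.signals ω, fun k : T => C.toScheme.cache k.1 ω))
      (fun ω => fun k : T => C.toScheme.demands ω k.1) = 0 := by
  -- What the users of `T` see depends on the demands only through those of the users of `T`.
  let view (d : T → Fin N) (w : Library N B × Demands K N) :
      (∀ k, C.toScheme.SendMeta k × List Bool) × (∀ k : T, C.toScheme.CacheMeta k × List Bool) :=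
    (fun k => (w.2, C.messageList k w.2 w.1),
      fun k => (d k - w.2 k, C.cacheList k (d k - w.2 k) w.1))
  have hview : (fun ω => (C.toScheme.signals ω, fun k : T => C.toScheme.cache k.1 ω)) ∘ C.outcome =
      fun ω => view (fun k => ω.1 k) ω.2 :=
    funext fun ω => Prod.ext (funext fun k => signal_outcome hloc k ω) rfl
  rw [law_toScheme, condMutualInfo_map, hview]
  exact condMutualInfo_prodLaw_eq_zero q _ (fun d (k : T) => d k) view

lemma meets_toScheme (hloc : C.IsLocal) (hdec : C.IsDecodable) {M R ε : ℝ}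
    (hmeta : K * Real.logb 2 N ≤ B * ε)
    (hcache : ∀ k r, Real.logb 2 N + (C.cached k r).card ≤ B * (M + ε))
    (hload : ∑ k, (K * Real.logb 2 N + Fintype.card (C.Index k)) ≤ B * (R + ε))
    (q : PMF (Demands K N)) : C.toScheme.Meets q M R ε := by
  have hlog := logb_two_natCast_nonneg N
  have hε : 0 ≤ B * ε := (mul_nonneg K.cast_nonneg hlog).trans hmeta
  refine ⟨fun k => ?_, fun k => (entropy_sendMeta_le q k).trans hmeta, fun k => ?_,
    fun k => (condEntropy_demandedFile_eq_zero hloc hdec q k).trans_le hε,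
    fun T _ => condMutualInfo_demands_eq_zero hloc q T,
    (Finset.sum_le_sum fun k _ => entropy_signal_le q k).trans hload⟩
  · have hK : (1 : ℝ) ≤ K := mod_cast k.pos
    exact (entropy_cacheMeta_le q k).trans ((le_mul_of_one_le_left hlog hK).trans hmeta)
  · obtain ⟨r, hr⟩ := Finite.exists_max fun r => (C.cached k r).card
    exact (entropy_cache_le q k hr).trans (hcache k r)

end ShiftCode

section Multicast

variable {V I G : Type*} [DecidableEq V]

/-- The multicast message of a set `S` of slots with demands `d`, where `A i W` is the part of
file `i` cached by exactly the slots of `W`: the sum over the slots `v` of `S` of the part of the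
file `d v` that is cached by the other slots of `S`. -/
def multicast [AddCommMonoid G] (d : V → I) (A : I → Finset V → G) (S : Finset V) : G :=
  ∑ v ∈ S, A (d v) (S.erase v)

lemma eq_of_multicast_eq [AddCancelCommMonoid G] {d : V → I} {v : V} {A A' : I → Finset V → G}
    (hcache : ∀ i W, v ∈ W → A i W = A' i W)
    (h : ∀ S, multicast d A S = multicast d A' S) (W : Finset V) : A (d v) W = A' (d v) W := by
  by_cases hv : v ∈ W
  · exact hcache _ _ hv
  have interference : ∑ w ∈ W, A (d w) ((insert v W).erase w) =
      ∑ w ∈ W, A' (d w) ((insert v W).erase w) :=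
    Finset.sum_congr rfl fun w hw => hcache _ _ <|
      Finset.mem_erase.2 ⟨(ne_of_mem_of_not_mem hw hv).symm, Finset.mem_insert_self v W⟩
  have hS := h (insert v W)
  rw [multicast, multicast, Finset.sum_insert hv, Finset.sum_insert hv, Finset.erase_insert hv,
    interference] at hS
  exact add_right_cancel hS

variable [Fintype I] [DecidableEq I]

/-- The sets of slots contained in `T` that demand each file exactly once, as sections of `d`. -/
def transversals (d : V → I) (T : Finset V) : Finset (I → V) :=
  Fintype.piFinset fun i => {v ∈ T | d v = i}

omit [DecidableEq V] in
lemma mem_transversals {d : V → I} {T : Finset V} {f : I → V} :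
    f ∈ transversals d T ↔ ∀ i, f i ∈ T ∧ d (f i) = i := by
  simp [transversals]

omit [DecidableEq V] in
lemma update_mem_transversals {d : V → I} {T : Finset V} {f : I → V} (hf : f ∈ transversals d T)
    {v : V} (hv : v ∈ T) : Function.update f (d v) v ∈ transversals d T := by
  rw [mem_transversals] at hf ⊢
  exact (Function.forall_update_iff f fun i w => w ∈ T ∧ d w = i).2 ⟨⟨hv, rfl⟩, fun i _ => hf i⟩

lemma insert_image_update (f : I → V) (i : I) (v : V) :
    insert (f i) (Finset.univ.image (Function.update f i v)) =
      insert v (Finset.univ.image f) := by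
  rw [← Finset.insert_erase (Finset.mem_univ i), Finset.image_insert, Finset.image_insert,
    Function.update_self, Finset.insert_comm]
  congr 2
  exact Finset.image_congr fun j hj => Function.update_of_ne (Finset.ne_of_mem_erase hj) v f

lemma sdiff_image_update_erase (T : Finset V) (f : I → V) (i : I) (v : V) :
    (T \ Finset.univ.image (Function.update f i v)).erase (f i) =
      (T \ Finset.univ.image f).erase v := by
  rw [← Finset.sdiff_insert, ← Finset.sdiff_insert, insert_image_update]

lemma apply_notMem_image_update {d : V → I} {T : Finset V} {f : I → V}
    (hf : f ∈ transversals d T) {v : V} (hv : v ∉ Finset.univ.image f) :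
    f (d v) ∉ Finset.univ.image (Function.update f (d v) v) := by
  have hfst := mem_transversals.1 hf
  simp only [Finset.mem_image, Finset.mem_univ, true_and, not_exists] at hv ⊢
  refine (Function.forall_update_iff f fun _ w => w ≠ f (d v)).2
    ⟨Ne.symm (hv (d v)), fun i hi h => hi ?_⟩
  rw [← (hfst i).2, h, (hfst _).2]

lemma sum_multicast_sdiff_transversals [AddCommGroup G] [Module (ZMod 2) G] (d : V → I)
    (A : I → Finset V → G) (T : Finset V) :
    ∑ f ∈ transversals d T, multicast d A (T \ Finset.univ.image f) = 0 := by
  unfold multicast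
  rw [Finset.sum_sigma']
  have sound : ∀ {a : (_ : I → V) × V},
      a ∈ (transversals d T).sigma (fun f => T \ Finset.univ.image f) →
      a.1 ∈ transversals d T ∧ a.2 ∈ T ∧ a.2 ∉ Finset.univ.image a.1 ∧ d (a.1 (d a.2)) = d a.2 := by
    intro a ha
    obtain ⟨hf, hv⟩ := Finset.mem_sigma.1 ha
    obtain ⟨hvT, hvf⟩ := Finset.mem_sdiff.1 hv
    exact ⟨hf, hvT, hvf, (mem_transversals.1 hf _).2⟩
  -- Exchanging `v` with the slot of the transversal that demands the same file preserves the
  -- summand, so the summands cancel in pairs.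
  refine Finset.sum_involution
    (fun a _ => ⟨Function.update a.1 (d a.2) a.2, a.1 (d a.2)⟩) ?_ ?_ ?_ ?_
  · rintro ⟨f, v⟩ ha
    obtain ⟨-, -, -, hd⟩ := sound ha
    dsimp only at hd ⊢
    rw [hd, sdiff_image_update_erase, ZModModule.add_self]
  · rintro ⟨f, v⟩ ha - h
    obtain ⟨-, -, hvf, -⟩ := sound ha
    exact hvf (Finset.mem_image.2 ⟨d v, Finset.mem_univ _, eq_of_heq (Sigma.mk.inj h).2⟩)
  · rintro ⟨f, v⟩ ha
    obtain ⟨hf, hv, hvf, -⟩ := sound ha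
    exact Finset.mem_sigma.2 ⟨update_mem_transversals hf hv,
      Finset.mem_sdiff.2 ⟨(mem_transversals.1 hf _).1, apply_notMem_image_update hf hvf⟩⟩
  · rintro ⟨f, v⟩ ha
    obtain ⟨-, -, -, hd⟩ := sound ha
    dsimp only at hd
    simp [hd]

lemma multicast_eq_sum_erase [AddCommGroup G] [Module (ZMod 2) G] {d : V → I} {T : Finset V}
    {u : I → V} (hu : u ∈ transversals d T) (A : I → Finset V → G) :
    multicast d A (T \ Finset.univ.image u) =
      ∑ f ∈ (transversals d T).erase u, multicast d A (T \ Finset.univ.image f) := by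
  have h := sum_multicast_sdiff_transversals d A T
  rw [← Finset.add_sum_erase _ _ hu] at h
  rw [eq_neg_of_add_eq_zero_left h, ZModModule.neg_eq_self]

omit [Fintype I] [DecidableEq I] in
lemma multicast_eq_of_leaders [Finite I] [AddCommGroup G] [Module (ZMod 2) G] {d : V → I}
    {u : I → V} (hu : ∀ i, d (u i) = i) {A A' : I → Finset V → G}
    (h : ∀ S, (∃ i, u i ∈ S) → multicast d A S = multicast d A' S) (S : Finset V) :
    multicast d A S = multicast d A' S := by
  classical
  cases nonempty_fintype I
  by_cases hS : ∃ i, u i ∈ S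
  · exact h S hS
  -- `S` is the complement of `u` in `T`, and any other transversal misses some `u i`.
  set T := S ∪ Finset.univ.image u
  have huT : u ∈ transversals d T := mem_transversals.2 fun i => ⟨by simp [T], hu i⟩
  have hTS : T \ Finset.univ.image u = S := by
    rw [Finset.union_sdiff_right, Finset.sdiff_eq_self_iff_disjoint, Finset.disjoint_right]
    simpa using hS
  rw [← hTS, multicast_eq_sum_erase huT, multicast_eq_sum_erase huT]
  refine Finset.sum_congr rfl fun f hf => h _ ?_
  obtain ⟨hne, hf⟩ := Finset.mem_erase.1 hf
  obtain ⟨i, hi⟩ := Function.ne_iff.1 hne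
  have hui : u i ∉ Finset.univ.image f := by
    simp only [Finset.mem_image, Finset.mem_univ, true_and, not_exists]
    intro j hj
    have hji : j = i := by rw [← (mem_transversals.1 hf j).2, hj, hu]
    exact hi (hji ▸ hj)
  exact ⟨i, Finset.mem_sdiff.2 ⟨(mem_transversals.1 huT i).1, hui⟩⟩

end Multicast

/-- The slots served by user `k`, one for every other user and every shift of that user. -/
abbrev Slot (K N : ℕ) (k : Fin K) : Type := {j : Fin K // j ≠ k} × Fin N

/-- The subdivision of a file: for every user `k` and every set `W` of slots served by `k` there
are `n |W|` bits transmitted by `k` and cached by exactly the slots of `W`. -/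
abbrev Part (K N : ℕ) (n : ℕ → ℕ) : Type :=
  Σ k : Fin K, Σ W : Finset (Slot K N k), Fin (n W.card)

section Code

variable {K N B L : ℕ} {n : ℕ → ℕ}

/-- User `j` with shift `r` caches the bits transmitted by user `k` and cached by the slots of `W`;
this includes all the bits that `j` itself transmits. -/
def Covers {k : Fin K} (W : Finset (Slot K N k)) (j : Fin K) (r : Fin N) : Prop :=
  ∀ h : j ≠ k, ((⟨j, h⟩, r) : Slot K N k) ∈ W

/-- User `j` with shift `r` caches a bit of a file that is divided into parts and `L` leftover
bits; the leftover bits are cached by all users. -/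
def IsCached (j : Fin K) (r : Fin N) : Part K N n ⊕ Fin L → Prop :=
  Sum.elim (fun p => Covers p.2.1 j r) fun _ => True

/-- The bits of file `i` transmitted by user `k` and cached by the slots of `W`, as a sequence of
scalars; sequences of different lengths are added after padding them with zeros. -/
def chunk (e : Fin B ≃ Part K N n ⊕ Fin L) (F : Library N B) (k : Fin K) (i : Fin N)
    (W : Finset (Slot K N k)) (l : ℕ) : ZMod 2 :=
  if h : l < n W.card then if F i (e.symm (.inl ⟨k, W, l, h⟩)) then 1 else 0 else 0

/-- The demands of the slots served by user `k`: the slot of user `j` for its actual shift demands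
the file that `j` demands, and the slots of `j` together demand every file exactly once. -/
def slotDemand (m : Demands K N) (k : Fin K) (v : Slot K N k) : Fin N := v.2 + m v.1

open Classical in
/-- The delivery of coded multicast messages by each user, only for the sets of slots that contain
a slot of its leading user; the other messages are redundant. -/
def multicastCode (lead : ∀ k : Fin K, {j : Fin K // j ≠ k}) (e : Fin B ≃ Part K N n ⊕ Fin L) :
    ShiftCode K N B where
  Index k := Σ S : {S : Finset (Slot K N k) // ∃ x, (lead k, x) ∈ S}, Fin (n (S.1.card - 1))
  indexFintype _ := inferInstance
  cached j r := {p | IsCached j r (e p.2)}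
  message k m F Sl := decide (multicast (slotDemand m k) (chunk e F k) Sl.1.1 Sl.2 = 1)

variable (lead : ∀ k : Fin K, {j : Fin K // j ≠ k}) (e : Fin B ≃ Part K N n ⊕ Fin L)

lemma apply_eq_of_agreeOn_cached {j : Fin K} {r : Fin N} {F F' : Library N B}
    (h : ShiftCode.AgreeOn ((multicastCode lead e).cached j r) F F') {x : Part K N n ⊕ Fin L}
    (hx : IsCached j r x) (i : Fin N) : F i (e.symm x) = F' i (e.symm x) :=
  h (i, e.symm x) (by simpa [multicastCode] using hx)

lemma chunk_eq_of_agreeOn_cached {j : Fin K} {r : Fin N} {F F' : Library N B}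
    (h : ShiftCode.AgreeOn ((multicastCode lead e).cached j r) F F') {k : Fin K}
    {W : Finset (Slot K N k)} (hW : Covers W j r) (i : Fin N) :
    chunk e F k i W = chunk e F' k i W := by
  funext l
  refine dite_congr rfl (fun hl => ?_) fun _ => rfl
  rw [apply_eq_of_agreeOn_cached lead e h (x := .inl ⟨k, W, l, hl⟩) hW i]

lemma isLocal_multicastCode : (multicastCode lead e).IsLocal := by
  intro k r m F F' h
  have hchunk : chunk e F k = chunk e F' k :=
    funext₂ fun i W => chunk_eq_of_agreeOn_cached lead e h (fun hk => (hk rfl).elim) i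
  simp only [multicastCode, hchunk]

lemma multicast_chunk_apply_eq_zero (F : Library N B) (k : Fin K) (d : Slot K N k → Fin N)
    {S : Finset (Slot K N k)} {l : ℕ} (hl : ¬ l < n (S.card - 1)) :
    multicast d (chunk e F k) S l = 0 := by
  rw [multicast, Finset.sum_apply]
  refine Finset.sum_eq_zero fun v hv => dif_neg ?_
  rwa [Finset.card_erase_of_mem hv]

lemma multicast_eq_of_message_eq [NeZero N] {k : Fin K} {m : Demands K N} {F F' : Library N B}
    (h : (multicastCode lead e).message k m F = (multicastCode lead e).message k m F')
    (S : Finset (Slot K N k)) :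
    multicast (slotDemand m k) (chunk e F k) S = multicast (slotDemand m k) (chunk e F' k) S := by
  have bit_ext : ∀ x y : ZMod 2, (x = 1 ↔ y = 1) → x = y := by decide
  have lead_demands : ∀ i, slotDemand m k (lead k, i - m (lead k)) = i :=
    fun i => sub_add_cancel _ _
  refine multicast_eq_of_leaders lead_demands ?_ S
  rintro S ⟨i, hi⟩
  funext l
  by_cases hl : l < n (S.card - 1)
  · exact bit_ext _ _ (decide_eq_decide.1 (congrFun h ⟨⟨S, _, hi⟩, l, hl⟩))
  · rw [multicast_chunk_apply_eq_zero e F k _ hl, multicast_chunk_apply_eq_zero e F' k _ hl]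

lemma isDecodable_multicastCode [NeZero N] : (multicastCode lead e).IsDecodable := by
  intro j r m F F' hcache hmessage
  have bit_injective : ∀ b b' : Bool, (if b then (1 : ZMod 2) else 0) = (if b' then 1 else 0) →
      b = b' := by decide
  have hchunk : ∀ k W, chunk e F k (r + m j) W = chunk e F' k (r + m j) W := by
    intro k W
    by_cases hjk : j = k
    · exact chunk_eq_of_agreeOn_cached lead e hcache (fun h => (h hjk).elim) _
    · exact eq_of_multicast_eq (d := slotDemand m k) (v := (⟨j, hjk⟩, r))
        (fun i W hW => chunk_eq_of_agreeOn_cached lead e hcache (fun _ => hW) i)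
        (multicast_eq_of_message_eq lead e (hmessage k)) W
  funext b
  obtain ⟨⟨k, W, l⟩ | x, rfl⟩ := e.symm.surjective b
  · have hl := congrFun (hchunk k W) l
    simp only [chunk, l.2, dif_pos] at hl
    exact bit_injective _ _ hl
  · exact apply_eq_of_agreeOn_cached lead e hcache (x := .inr x) trivial _

end Code

section Counting

variable {V R : Type*} [Fintype V] [DecidableEq V]

omit [DecidableEq V] in
lemma sum_apply_card [NonAssocSemiring R] (f : ℕ → R) :
    ∑ W : Finset V, f W.card =
      ∑ s ∈ Finset.range (Fintype.card V + 1), ((Fintype.card V).choose s : R) * f s := by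
  simp_rw [← nsmul_eq_mul]
  rw [← Finset.powerset_univ, Finset.sum_powerset_apply_card, Finset.card_univ]

lemma sum_subset_apply_card [NonAssocSemiring R] (Q : Finset V) (f : ℕ → R) :
    ∑ W : Finset V with W ⊆ Q, f W.card =
      ∑ s ∈ Finset.range (Fintype.card V + 1), (Q.card.choose s : R) * f s := by
  simp_rw [← nsmul_eq_mul]
  rw [show ({W | W ⊆ Q} : Finset (Finset V)) = Q.powerset by ext; simp,
    Finset.sum_powerset_apply_card]
  refine Finset.sum_subset (Finset.range_mono (Nat.succ_le_succ Q.card_le_univ)) fun s _ hs => ?_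
  rw [Nat.choose_eq_zero_of_lt (by simpa using hs), zero_nsmul]

lemma sum_not_subset_apply_card [NonAssocRing R] (Q : Finset V) (f : ℕ → R) :
    ∑ W : Finset V with ¬ W ⊆ Q, f W.card = ∑ s ∈ Finset.range (Fintype.card V + 1),
      (((Fintype.card V).choose s : R) - Q.card.choose s) * f s := by
  have h := Finset.sum_filter_add_sum_filter_not Finset.univ (fun W : Finset V => W ⊆ Q)
    fun W => f W.card
  rw [sum_apply_card, sum_subset_apply_card] at h
  simp_rw [sub_mul, Finset.sum_sub_distrib]
  exact eq_sub_of_add_eq' h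

lemma sum_not_subset_apply_card_sub_one [NonAssocRing R] (Q : Finset V) (f : ℕ → R) :
    ∑ W : Finset V with ¬ W ⊆ Q, f (W.card - 1) = ∑ s ∈ Finset.range (Fintype.card V + 1),
      (((Fintype.card V).choose (s + 1) : R) - Q.card.choose (s + 1)) * f s := by
  rw [sum_not_subset_apply_card Q fun s => f (s - 1), Finset.sum_range_succ',
    Finset.sum_range_succ _ (Fintype.card V), Nat.choose_succ_self,
    Nat.choose_eq_zero_of_lt (Nat.lt_succ_of_le Q.card_le_univ)]
  simp only [Nat.add_sub_cancel, Nat.choose_zero_right, sub_self, zero_mul]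

lemma sum_mem_apply_card_eq [AddCommMonoid R] (f : ℕ → R) (v w : V) :
    ∑ W : Finset V with v ∈ W, f W.card = ∑ W : Finset V with w ∈ W, f W.card := by
  refine Finset.sum_equiv (Equiv.swap v w).finsetCongr (fun W => ?_) fun W _ => ?_
  · simp [Finset.mem_map_equiv]
  · simp

lemma card_mul_sum_mem_apply_card [NonAssocSemiring R] (f : ℕ → R) (v : V) :
    (Fintype.card V : R) * ∑ W : Finset V with v ∈ W, f W.card =
      ∑ W : Finset V, (W.card : R) * f W.card := by
  calc (Fintype.card V : R) * ∑ W : Finset V with v ∈ W, f W.card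
      = ∑ w : V, ∑ W : Finset V with w ∈ W, f W.card := by
        rw [Finset.sum_congr rfl fun _ _ => sum_mem_apply_card_eq f _ v, Finset.sum_const,
          Finset.card_univ, nsmul_eq_mul]
    _ = ∑ W : Finset V, ∑ _w ∈ W, f W.card := Finset.sum_comm' (by simp)
    _ = ∑ W : Finset V, (W.card : R) * f W.card := by
        simp only [Finset.sum_const, nsmul_eq_mul]

end Counting

/-- The number `U` of slots served by each user. -/
abbrev slotCount (K N : ℕ) : ℕ := (K - 1) * N

/-- The cache size and the load of the multicast code in which every bit is cached by exactly `s`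
slots: the corner point of the paper with `t = s + 1`. -/
def cornerPoint (K N s : ℕ) : ℝ × ℝ :=
  (((N : ℝ) + s) / K,
    (((slotCount K N).choose (s + 1) : ℝ) - ((slotCount K N - N).choose (s + 1) : ℝ)) /
      ((slotCount K N).choose s : ℝ))

/-- The number of bits of each file in the parts that are cached by exactly `s` slots. -/
def layerSize (K N : ℕ) (n : ℕ → ℕ) (s : ℕ) : ℕ :=
  K * (slotCount K N).choose s * n s

section Size

variable {K N B L : ℕ} {n : ℕ → ℕ}

lemma card_slot (k : Fin K) : Fintype.card (Slot K N k) = slotCount K N := by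
  simp [Fintype.card_subtype_compl]

lemma card_part : Fintype.card (Part K N n) =
    ∑ s ∈ Finset.range (slotCount K N + 1), layerSize K N n s := by
  have hpart (k : Fin K) : ∑ W : Finset (Slot K N k), n W.card =
      ∑ s ∈ Finset.range (slotCount K N + 1), (slotCount K N).choose s * n s := by
    simpa [card_slot k] using sum_apply_card (V := Slot K N k) n
  simp only [Fintype.card_sigma, Fintype.card_fin, hpart, Finset.sum_const, Finset.card_univ,
    smul_eq_mul, Finset.mul_sum, layerSize, mul_assoc]

variable (lead : ∀ k : Fin K, {j : Fin K // j ≠ k}) (e : Fin B ≃ Part K N n ⊕ Fin L)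

lemma card_slot_ne_lead (k : Fin K) :
    Finset.card {v : Slot K N k | v.1 ≠ lead k} = slotCount K N - N := by
  rw [← Finset.compl_filter, Finset.card_compl, card_slot]
  congr 1
  rw [show ({v : Slot K N k | v.1 = lead k} : Finset _) = {lead k} ×ˢ Finset.univ by
      ext ⟨j, x⟩; simp [eq_comm],
    Finset.card_product, Finset.card_singleton, Finset.card_univ, Fintype.card_fin, one_mul]

lemma card_index (k : Fin K) : (Fintype.card ((multicastCode lead e).Index k) : ℝ) =
    ∑ s ∈ Finset.range (slotCount K N + 1),
      (((slotCount K N).choose (s + 1) : ℝ) - (slotCount K N - N).choose (s + 1)) * n s := by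
  classical
  have hindex : Fintype.card ((multicastCode lead e).Index k) =
      ∑ S : {S : Finset (Slot K N k) // ∃ x, (lead k, x) ∈ S}, n (S.1.card - 1) :=
    Fintype.card_sigma.trans (Finset.sum_congr rfl fun _ _ => Fintype.card_fin _)
  have hmeet : ∀ S : Finset (Slot K N k),
      S ∈ ({S | ¬ S ⊆ ({v | v.1 ≠ lead k} : Finset _)} : Finset (Finset (Slot K N k))) ↔
        ∃ x, (lead k, x) ∈ S := by
    intro S
    simp [Finset.not_subset]
  have hcount := sum_not_subset_apply_card_sub_one
    ({v | v.1 ≠ lead k} : Finset (Slot K N k)) fun s => (n s : ℝ)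
  rw [card_slot, card_slot_ne_lead, Finset.sum_subtype _ hmeet fun S => (n (S.card - 1) : ℝ)]
    at hcount
  rw [hindex, Nat.cast_sum, ← hcount]

lemma sum_card_index : ∑ k, (Fintype.card ((multicastCode lead e).Index k) : ℝ) =
    ∑ s ∈ Finset.range (slotCount K N + 1), layerSize K N n s * (cornerPoint K N s).2 := by
  simp only [card_index, Finset.sum_const, Finset.card_univ, Fintype.card_fin, nsmul_eq_mul,
    Finset.mul_sum]
  refine Finset.sum_congr rfl fun s hs => ?_
  have hchoose : ((slotCount K N).choose s : ℝ) ≠ 0 :=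
    Nat.cast_ne_zero.2 (Nat.choose_pos (Finset.mem_range_succ_iff.1 hs)).ne'
  rw [layerSize, cornerPoint, Nat.cast_mul, Nat.cast_mul]
  field_simp

open Classical in
lemma card_cached_eq (j : Fin K) (r : Fin N) : ((multicastCode lead e).cached j r).card =
    N * (∑ k, ∑ W : Finset (Slot K N k) with Covers W j r, n W.card + L) := by
  have hprod : (multicastCode lead e).cached j r =
      Finset.univ ×ˢ ({b | IsCached j r (e b)} : Finset (Fin B)) := by
    ext p
    simp [multicastCode]
  have hparts : (∑ p : Part K N n, if IsCached j r (.inl p : Part K N n ⊕ Fin L) then 1 else 0) =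
      ∑ k, ∑ W : Finset (Slot K N k) with Covers W j r, n W.card := by
    rw [Fintype.sum_sigma]
    refine Finset.sum_congr rfl fun k _ => ?_
    rw [Fintype.sum_sigma, Finset.sum_filter]
    refine Finset.sum_congr rfl fun W _ => ?_
    by_cases hW : Covers W j r <;> simp [IsCached, hW]
  rw [hprod, Finset.card_product, Finset.card_univ, Fintype.card_fin, Finset.card_filter,
    Equiv.sum_comp e fun x => if IsCached j r x then 1 else 0, Fintype.sum_sum_type, hparts]
  simp [IsCached]

open Classical in
lemma slotCount_mul_sum_covers {j k : Fin K} (hjk : j ≠ k) (r : Fin N) :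
    slotCount K N * ∑ W : Finset (Slot K N k) with Covers W j r, n W.card =
      ∑ s ∈ Finset.range (slotCount K N + 1), (slotCount K N).choose s * (s * n s) := by
  have hcovers : ∀ W : Finset (Slot K N k), Covers W j r ↔ ((⟨j, hjk⟩, r) : Slot K N k) ∈ W :=
    fun W => ⟨fun h => h hjk, fun h _ => h⟩
  have hcount := (card_mul_sum_mem_apply_card n ((⟨j, hjk⟩, r) : Slot K N k)).trans
    (sum_apply_card fun s => Nat.cast s * n s)
  simpa only [hcovers, card_slot, Nat.cast_id] using hcount

open Classical in
lemma sum_sum_covers (hK : 2 ≤ K) (j : Fin K) (r : Fin N) :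
    N * ∑ k, ∑ W : Finset (Slot K N k) with Covers W j r, n W.card =
      ∑ s ∈ Finset.range (slotCount K N + 1), (slotCount K N).choose s * ((N + s) * n s) := by
  have own : ∑ W : Finset (Slot K N j) with Covers W j r, n W.card =
      ∑ s ∈ Finset.range (slotCount K N + 1), (slotCount K N).choose s * n s := by
    rw [Finset.filter_true_of_mem fun W _ hj => (hj rfl).elim]
    simpa [card_slot j] using sum_apply_card (V := Slot K N j) n
  have others : N * ∑ k ∈ Finset.univ.erase j, ∑ W : Finset (Slot K N k) with Covers W j r,
      n W.card = ∑ s ∈ Finset.range (slotCount K N + 1), (slotCount K N).choose s * (s * n s) := by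
    refine Nat.eq_of_mul_eq_mul_left (Nat.sub_pos_of_lt hK) ?_
    rw [← mul_assoc, Finset.mul_sum, Finset.sum_congr rfl fun k hk =>
      slotCount_mul_sum_covers (Finset.ne_of_mem_erase hk).symm r]
    simp
  rw [← Finset.add_sum_erase _ _ (Finset.mem_univ j), mul_add, own, others, Finset.mul_sum,
    ← Finset.sum_add_distrib]
  exact Finset.sum_congr rfl fun s _ => by ring

lemma card_cached (hK : 2 ≤ K) (j : Fin K) (r : Fin N) :
    (((multicastCode lead e).cached j r).card : ℝ) =
      ∑ s ∈ Finset.range (slotCount K N + 1), layerSize K N n s * (cornerPoint K N s).1 +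
        N * L := by
  have hK0 : (K : ℝ) ≠ 0 := by positivity
  rw [card_cached_eq, mul_add, sum_sum_covers hK, Nat.cast_add, Nat.cast_mul, Nat.cast_sum]
  congr 1
  refine Finset.sum_congr rfl fun s _ => ?_
  simp only [layerSize, cornerPoint, Nat.cast_mul, Nat.cast_add]
  field_simp

end Size

section Achievability

variable {K N B : ℕ} {w : ℕ → ℝ}

lemma mul_floor_div_le {c x : ℝ} (hc : 0 < c) (hx : 0 ≤ x) : c * ⌊x / c⌋₊ ≤ x :=
  (mul_le_mul_of_nonneg_left (Nat.floor_le (div_nonneg hx hc.le)) hc.le).trans_eq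
    (mul_div_cancel₀ x hc.ne')

lemma le_mul_floor_div_add {c : ℝ} (hc : 0 < c) (x : ℝ) : x ≤ c * ⌊x / c⌋₊ + c := by
  rw [← mul_add_one, ← div_le_iff₀' hc]
  exact (Nat.lt_floor_add_one _).le

/-- The part sizes for memory sharing between the corner points with weights `w`: up to rounding,
the bits cached by exactly `s` slots take up a proportion `w s` of each file. -/
def partSize (K N : ℕ) (w : ℕ → ℝ) (B s : ℕ) : ℕ :=
  ⌊w s * B / (K * (slotCount K N).choose s)⌋₊

lemma mul_choose_pos (hK : 0 < K) {s : ℕ} (hs : s ∈ Finset.range (slotCount K N + 1)) :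
    (0 : ℝ) < K * (slotCount K N).choose s :=
  mul_pos (Nat.cast_pos.2 hK) (Nat.cast_pos.2 (Nat.choose_pos (Finset.mem_range_succ_iff.1 hs)))

lemma layerSize_partSize_le (hK : 0 < K) {s : ℕ} (hs : s ∈ Finset.range (slotCount K N + 1))
    (hw : 0 ≤ w s) : (layerSize K N (partSize K N w B) s : ℝ) ≤ w s * B := by
  rw [layerSize, Nat.cast_mul, Nat.cast_mul]
  exact mul_floor_div_le (mul_choose_pos hK hs) (mul_nonneg hw B.cast_nonneg)

lemma le_layerSize_partSize_add (hK : 0 < K) {s : ℕ}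
    (hs : s ∈ Finset.range (slotCount K N + 1)) :
    w s * B ≤ layerSize K N (partSize K N w B) s + K * (slotCount K N).choose s := by
  rw [layerSize, Nat.cast_mul, Nat.cast_mul]
  exact le_mul_floor_div_add (mul_choose_pos hK hs) _

lemma sum_layerSize_partSize_mul_le (hK : 0 < K)
    (hw : ∀ s ∈ Finset.range (slotCount K N + 1), 0 ≤ w s) {x : ℕ → ℝ} (hx : 0 ≤ x) :
    ∑ s ∈ Finset.range (slotCount K N + 1), layerSize K N (partSize K N w B) s * x s ≤
      B * ∑ s ∈ Finset.range (slotCount K N + 1), w s * x s := by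
  rw [Finset.mul_sum]
  refine Finset.sum_le_sum fun s hs => ?_
  calc layerSize K N (partSize K N w B) s * x s
      ≤ w s * B * x s :=
        mul_le_mul_of_nonneg_right (layerSize_partSize_le hK hs (hw s hs)) (hx s)
    _ = B * (w s * x s) := by ring

lemma card_part_partSize_le (hK : 0 < K)
    (hw : ∀ s ∈ Finset.range (slotCount K N + 1), 0 ≤ w s)
    (hw1 : ∑ s ∈ Finset.range (slotCount K N + 1), w s = 1) :
    Fintype.card (Part K N (partSize K N w B)) ≤ B := by
  rw [← Nat.cast_le (α := ℝ), card_part]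
  simpa [hw1] using sum_layerSize_partSize_mul_le (B := B) hK hw (x := 1) zero_le_one

lemma le_card_part_partSize_add (hK : 0 < K)
    (hw1 : ∑ s ∈ Finset.range (slotCount K N + 1), w s = 1) :
    (B : ℝ) ≤ Fintype.card (Part K N (partSize K N w B)) +
      ∑ s ∈ Finset.range (slotCount K N + 1), (K : ℝ) * (slotCount K N).choose s := by
  rw [card_part, Nat.cast_sum, ← Finset.sum_add_distrib, ← one_mul (B : ℝ), ← hw1, Finset.sum_mul]
  exact Finset.sum_le_sum fun s hs => le_layerSize_partSize_add hK hs

lemma cornerPoint_nonneg (K N s : ℕ) : 0 ≤ cornerPoint K N s := by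
  refine ⟨by simp only [cornerPoint]; positivity, div_nonneg (sub_nonneg.2 ?_) (Nat.cast_nonneg _)⟩
  exact Nat.cast_le.2 (Nat.choose_le_choose _ (Nat.sub_le _ N))

/-- The number of bits, independent of `B`, by which the scheme with memory sharing exceeds the
cache size and the load: the leftover bits of all files and the metadata. -/
def overhead (K N : ℕ) : ℝ :=
  N * ∑ s ∈ Finset.range (slotCount K N + 1), (K : ℝ) * (slotCount K N).choose s +
    K * K * Real.logb 2 N

lemma overhead_nonneg (K N : ℕ) : 0 ≤ overhead K N :=
  add_nonneg (by positivity) (mul_nonneg (by positivity) (logb_two_natCast_nonneg N))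

lemma leftover_add_metadata_le_overhead (hK : 0 < K)
    (hw : ∀ s ∈ Finset.range (slotCount K N + 1), 0 ≤ w s)
    (hw1 : ∑ s ∈ Finset.range (slotCount K N + 1), w s = 1) :
    (N : ℝ) * (B - Fintype.card (Part K N (partSize K N w B)) : ℕ) + K * K * Real.logb 2 N ≤
      overhead K N := by
  rw [overhead, Nat.cast_sub (card_part_partSize_le hK hw hw1)]
  gcongr
  exact sub_le_iff_le_add'.2 (le_card_part_partSize_add hK hw1)

lemma exists_isUncoded_meets (hK : 2 ≤ K) (hN : 0 < N)
    (hw : ∀ s ∈ Finset.range (slotCount K N + 1), 0 ≤ w s)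
    (hw1 : ∑ s ∈ Finset.range (slotCount K N + 1), w s = 1) {ε : ℝ}
    (hε : overhead K N ≤ B * ε) :
    ∃ 𝒮 : Scheme K N B, 𝒮.IsUncoded ∧ ∀ q : PMF (Demands K N), 𝒮.Meets q
      (∑ s ∈ Finset.range (slotCount K N + 1), w s * (cornerPoint K N s).1)
      (∑ s ∈ Finset.range (slotCount K N + 1), w s * (cornerPoint K N s).2) ε := by
  have : NeZero N := ⟨hN.ne'⟩
  have : Nontrivial (Fin K) := Fin.nontrivial_iff_two_le.2 hK
  have hK0 : 0 < K := zero_lt_two.trans_le hK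
  have hK1 : (1 : ℝ) ≤ K := mod_cast hK0
  have hlog : 0 ≤ Real.logb 2 N := logb_two_natCast_nonneg N
  have hleft := (leftover_add_metadata_le_overhead (B := B) hK0 hw hw1).trans hε
  set L := B - Fintype.card (Part K N (partSize K N w B)) with hL
  let e : Fin B ≃ Part K N (partSize K N w B) ⊕ Fin L := Fintype.equivOfCardEq <| by
    rw [Fintype.card_sum, Fintype.card_fin, Fintype.card_fin, hL,
      Nat.add_sub_cancel' (card_part_partSize_le hK0 hw hw1)]
  choose lead hlead using fun k : Fin K => exists_ne k
  let C := multicastCode (fun k => ⟨lead k, hlead k⟩) e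
  have hNL : (0 : ℝ) ≤ N * L := by positivity
  have hKlog : K * Real.logb 2 N ≤ K * K * Real.logb 2 N := by
    gcongr
    exact le_mul_of_one_le_left K.cast_nonneg hK1
  have hlogK : Real.logb 2 N ≤ K * Real.logb 2 N := le_mul_of_one_le_left hlog hK1
  refine ⟨C.toScheme, C.isUncoded_toScheme, ShiftCode.meets_toScheme
    (isLocal_multicastCode _ e) (isDecodable_multicastCode _ e) (by linarith) (fun k r => ?_) ?_⟩
  · have hcache := sum_layerSize_partSize_mul_le (B := B) hK0 hw
      (x := fun s => (cornerPoint K N s).1) fun s => (cornerPoint_nonneg K N s).1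
    rw [card_cached _ e hK]
    linarith
  · have hload := sum_layerSize_partSize_mul_le (B := B) hK0 hw
      (x := fun s => (cornerPoint K N s).2) fun s => (cornerPoint_nonneg K N s).2
    rw [Finset.sum_add_distrib, sum_card_index _ e, Fin.sum_const, nsmul_eq_mul]
    linarith

lemma achievable_sum_smul_cornerPoint (hK : 2 ≤ K) (hN : 0 < N)
    (hw : ∀ s ∈ Finset.range (slotCount K N + 1), 0 ≤ w s)
    (hw1 : ∑ s ∈ Finset.range (slotCount K N + 1), w s = 1) :
    Achievable K N (∑ s ∈ Finset.range (slotCount K N + 1), w s • cornerPoint K N s).1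
      (∑ s ∈ Finset.range (slotCount K N + 1), w s • cornerPoint K N s).2 := by
  simp only [Prod.fst_sum, Prod.snd_sum, Prod.smul_fst, Prod.smul_snd, smul_eq_mul]
  refine ⟨fun B => overhead K N / B, fun B => div_nonneg (overhead_nonneg K N) B.cast_nonneg,
    tendsto_const_div_atTop_nhds_zero_nat _, ?_⟩
  filter_upwards [Filter.eventually_ne_atTop 0] with B hB
  exact exists_isUncoded_meets hK hN hw hw1 (mul_div_cancel₀ _ (Nat.cast_ne_zero.2 hB)).ge

lemma schemeAPoints_eq_image (K N : ℕ) :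
    schemeAPoints K N = cornerPoint K N '' (Finset.range (slotCount K N + 1)) := by
  have hpoint : ∀ s : ℕ, ((((N : ℝ) + (s + 1 : ℕ) - 1) / K,
      (((slotCount K N).choose (s + 1) : ℝ) - ((slotCount K N - N).choose (s + 1) : ℝ)) /
        ((slotCount K N).choose (s + 1 - 1) : ℝ))) = cornerPoint K N s := by
    intro s
    rw [cornerPoint, Nat.cast_add_one, ← add_assoc, add_sub_cancel_right, Nat.add_sub_cancel]
  ext P
  simp only [Set.mem_image, Finset.coe_range, Set.mem_Iio]
  constructor
  · rintro ⟨t, ht, htU, rfl⟩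
    obtain ⟨s, rfl⟩ := Nat.exists_eq_add_of_le' ht
    exact ⟨s, htU, (hpoint s).symm⟩
  · rintro ⟨s, hs, rfl⟩
    exact ⟨s + 1, Nat.le_add_left 1 s, hs, (hpoint s).symm⟩

lemma cornerPoint_injective (hK : K ≠ 0) : (cornerPoint K N).Injective := by
  intro s s' h
  have hfst := congrArg Prod.fst h
  simpa [cornerPoint, div_left_inj' (Nat.cast_ne_zero.2 hK : (K : ℝ) ≠ 0)] using hfst

lemma achievable_of_mem_convexHull (hK : 2 ≤ K) (hN : 0 < N) {M R : ℝ}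
    (h : (M, R) ∈ convexHull ℝ (schemeAPoints K N)) : Achievable K N M R := by
  classical
  have hinj := cornerPoint_injective (N := N) (by omega : K ≠ 0)
  rw [schemeAPoints_eq_image, ← Finset.coe_image, Finset.mem_convexHull'] at h
  obtain ⟨w, hw, hw1, hwx⟩ := h
  rw [Finset.sum_image hinj.injOn] at hw1 hwx
  have hach := achievable_sum_smul_cornerPoint hK hN
    (fun s hs => hw _ (Finset.mem_image_of_mem _ hs)) hw1
  rwa [hwx] at hach

end Achievability

end D2DCaching

end

theorem theorem1 (K N : ℕ) (hK : 2 ≤ K) (hN : 2 ≤ N) (M : ℝ)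
    (hM : M ∈ Set.Icc ((N : ℝ) / K) (N : ℝ)) :
    D2DCaching.optimalLoad K N M ≤
      D2DCaching.lowerConvexEnvelope (D2DCaching.schemeAPoints K N) M := by
  refine le_sInf ?_
  rintro _ ⟨R, hR, rfl⟩
  exact sInf_le ⟨R, D2DCaching.achievable_of_mem_convexHull hK (zero_lt_two.trans_le hN) hR, rfl⟩
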